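/- **Setting.** Let $\mathcal F$ be a signature (function symbols with fixed arities), $\mathcal V$ a countably infinite set of variables, and $\mathcal R$ a term rewrite system, i.e. a finite set of rules $l\to r$ between terms over $\mathcal F$ and $\mathcal V$ such that $l$ is not a variable and every variable of $r$ occurs in $l$. Let $\mathcal D$ be the set of defined symbols (roots of left-hand sides) and $\mathcal C=\mathcal F\setminus\mathcal D$ the set of constructors. Values are terms built from constructors and variables; a basic term is $f(v_1,\dots,v_n)$ with $f\in\mathcal D$ and all $v_i$ values. $\mathcal R$ is a constructor TRS if all left-hand sides are basic. **Precedence and safe mapping.** Let $\succsim$ be a preorder on $\mathcal F$ with strict part $\succ$ and equivalence $\sim$. It is admissible if (i) $f\succ g$ and $g\in\mathcal D$ imply $f\in\mathcal D$, and (ii) $f\sim g$ implies $f\in\mathcal D\Leftrightarrow g\in\mathcal D$. A safe mapping assigns to each $n$-ary $f$ a set $\mathsf{safe}(f)\subseteq\{1,\dots,n\}$ of safe argument positions, with $\mathsf{safe}(f)=\{1,\dots,n\}$ for $f\in\mathcal C$; the other positions are normal. For a term $t=f(t_1,\dots,t_n)$, $\mathsf{safe}(t)$ and $\mathsf{nrm}(t)$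 denote the multisets of its arguments at safe and at normal positions. **The orders.** Term equivalence $\approx_{\mathsf s}$ is the least relation such that $s\approx_{\mathsf s}t$ if $s=t$, or $s=f(s_1,\dots,s_n)$, $t=g(t_1,\dots,t_n)$, $f\sim g$ and there is a permutation $\pi$ with $s_i\approx_{\mathsf s}t_{\pi(i)}$ and ($i\in\mathsf{safe}(f)\Leftrightarrow\pi(i)\in\mathsf{safe}(g)$) for all $i$. The relation $>_{\mathsf{sq}}$ is defined inductively: $s=f(s_1,\dots,s_n)>_{\mathsf{sq}}t$ if 1. $s_i>_{\mathsf{sq}}t$ or $s_i\approx_{\mathsf s}t$ for some $i$, where $i$ is a normal position of $f$ if $f\in\mathcal D$; or 2. $t=g(t_1,\dots,t_m)$, $f\succ g$, $f\in\mathcal D$ and $s>_{\mathsf{sq}}t_j$ for all $j$. The polynomial path order $>_{\mathsf{pop}*}$ is defined inductively: $s=f(s_1,\dots,s_n)>_{\mathsf{pop}*}t$ if $s>_{\mathsf{sq}}t$, or 1. $s_i>_{\mathsf{pop}*}t$ or $s_i\approx_{\mathsf s}t$ for some $i$; or 2. $t=g(t_1,\dots,t_m)$, $f\succ g$, $f\in\mathcal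 D$, and there is $j_0\in\mathsf{safe}(g)$ with $s>_{\mathsf{pop}*}t_{j_0}$ such that for all $j\ne j_0$ either $s>_{\mathsf{sq}}t_j$, or $t_j$ is a proper subterm of $s$ and $j\in\mathsf{safe}(g)$; or 3. $t=g(t_1,\dots,t_m)$, $f\sim g$, $\mathsf{nrm}(s)>^{\mathrm{mul}}_{\mathsf{pop}*}\mathsf{nrm}(t)$ and $\mathsf{safe}(s)\geq^{\mathrm{mul}}_{\mathsf{pop}*}\mathsf{safe}(t)$. Here $M\geq^{\mathrm{mul}}_{\mathsf{pop}*}N$ means that $M=X\uplus Z$ and $N=Y\uplus W$, where the elements of $Z$ and $W$ can be paired off so that paired elements are $\approx_{\mathsf s}$-equivalent, and for every $y\in Y$ there is $x\in X$ with $x>_{\mathsf{pop}*}y$; and $M>^{\mathrm{mul}}_{\mathsf{pop}*}N$ means that this is possible with $X\neq\varnothing$. **Complexity.** An innermost rewrite step contracts a redex all of whose proper subterms are normal forms of $\mathcal R$. The innermost runtime complexity $\mathrm{rc}^{\mathsf i}_{\mathcal R}(n)$ is the maximal length of an innermost derivation starting in a basic term of size at most $n$ (the size of a term being its number of occurrences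 of function symbols and variables; the maximum over an empty set of terms is $0$, and $\mathrm{rc}^{\mathsf i}_{\mathcal R}(n)=\infty$ if these lengths are unbounded). **Theorem.** Let $\mathcal R$ be a constructor TRS, $\succsim$ an admissible precedence and $\mathsf{safe}$ a safe mapping. If $l>_{\mathsf{pop}*}r$ for every rule $l\to r$ of $\mathcal R$, with $>_{\mathsf{pop}*}$ induced by $\succsim$ and $\mathsf{safe}$, then the innermost runtime complexity of $\mathcal R$ is polynomially bounded: there is a polynomial $p$ with natural number coefficients such that $\mathrm{rc}^{\mathsf i}_{\mathcal R}(n)\le p(n)$ for all $n\in\mathbb N$ (in particular, it is finite). -/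

import Mathlib

namespace PopStar

/-- First-order terms over a signature `F` with arity function `ar` and variables `V`. -/
inductive Term {F : Type*} (ar : F → ℕ) (V : Type*)
  | var (x : V) : Term ar V
  | app (f : F) (ts : Fin (ar f) → Term ar V) : Term ar V

section Terms

variable {F V : Type*} {ar : F → ℕ}

/-- The set of variables occurring in a term. -/
def Term.vars : Term ar V → Set V
  | .var x => {x}
  | .app _ ts => ⋃ i, (ts i).vars

/-- The size of a term: the number of occurrences of symbols and variables. -/
def Term.size : Term ar V → ℕ
  | .var _ => 1
  | .app _ ts => 1 + ∑ i, (ts i).size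

/-- Application of a substitution. -/
def Term.subst (σ : V → Term ar V) : Term ar V → Term ar V
  | .var x => σ x
  | .app f ts => .app f (fun i => (ts i).subst σ)

/-- `ProperSubterm u s`: the term `u` is a proper subterm of `s`. -/
inductive ProperSubterm : Term ar V → Term ar V → Prop
  | arg (f : F) (ss : Fin (ar f) → Term ar V) (i : Fin (ar f)) :
      ProperSubterm (ss i) (.app f ss)
  | deep (f : F) (ss : Fin (ar f) → Term ar V) (i : Fin (ar f)) {u : Term ar V}
      (h : ProperSubterm u (ss i)) : ProperSubterm u (.app f ss)

/-- `IsValue D t`: no symbol of `D` occurs in `t`. With `D` the set of defined symbols,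
these are the terms built from constructors and variables only. -/
def IsValue (D : Set F) : Term ar V → Prop
  | .var _ => True
  | .app f ts => f ∉ D ∧ ∀ i, IsValue D (ts i)

/-- Basic terms: a defined symbol applied to values. -/
def IsBasic (D : Set F) : Term ar V → Prop
  | .var _ => False
  | .app f ts => f ∈ D ∧ ∀ i, IsValue D (ts i)

end Terms

/-- A term rewrite system: a finite set of rules `l → r` (as pairs `(l, r)`) such that `l` is not
a variable and every variable of `r` occurs in `l`. -/
structure TRS {F : Type*} (ar : F → ℕ) (V : Type*) where
  rules : Set (Term ar V × Term ar V)
  finite_rules : rules.Finite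
  lhs_not_var : ∀ l r, (l, r) ∈ rules → ∀ x, l ≠ .var x
  vars_subset : ∀ l r, (l, r) ∈ rules → r.vars ⊆ l.vars

section Rewriting

variable {F V : Type*} {ar : F → ℕ}

/-- The defined symbols: the root symbols of left-hand sides. All others are constructors. -/
def TRS.defined (R : TRS ar V) : Set F :=
  {f | ∃ ts r, (Term.app f ts, r) ∈ R.rules}

/-- A constructor TRS: every left-hand side is a basic term. -/
def TRS.IsConstructor (R : TRS ar V) : Prop :=
  ∀ l r, (l, r) ∈ R.rules → IsBasic R.defined l

/-- The rewrite relation of a TRS. -/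
inductive Rew (R : TRS ar V) : Term ar V → Term ar V → Prop
  | root (l r : Term ar V) (h : (l, r) ∈ R.rules) (σ : V → Term ar V) :
      Rew R (l.subst σ) (r.subst σ)
  | arg (f : F) (ts : Fin (ar f) → Term ar V) (i : Fin (ar f)) {u : Term ar V}
      (h : Rew R (ts i) u) : Rew R (.app f ts) (.app f (Function.update ts i u))

/-- Normal forms of a TRS. -/
def NormalForm (R : TRS ar V) (t : Term ar V) : Prop := ∀ u, ¬ Rew R t u

/-- The innermost rewrite relation: all proper subterms of the contracted redex are normal
forms. -/
inductive InnermostRew (R : TRS ar V) : Term ar V → Term ar V → Prop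
  | root (l r : Term ar V) (h : (l, r) ∈ R.rules) (σ : V → Term ar V)
      (hnf : ∀ u, ProperSubterm u (l.subst σ) → NormalForm R u) :
      InnermostRew R (l.subst σ) (r.subst σ)
  | arg (f : F) (ts : Fin (ar f) → Term ar V) (i : Fin (ar f)) {u : Term ar V}
      (h : InnermostRew R (ts i) u) :
      InnermostRew R (.app f ts) (.app f (Function.update ts i u))

/-- The `n`-fold composition of a relation with itself. -/
def StepsN {α : Type*} (r : α → α → Prop) : ℕ → α → α → Prop
  | 0, a, b => a = b
  | n + 1, a, b => ∃ c, r a c ∧ StepsN r n c b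

/-- The derivation length of `s`, that is, the supremum of the lengths of derivations from `s`.
It takes the value `⊤` if these lengths are unbounded, in particular if there is an infinite
derivation. -/
noncomputable def derivationLength {α : Type*} (r : α → α → Prop) (s : α) : ℕ∞ :=
  ⨆ (n : ℕ) (_ : ∃ t, StepsN r n s t), (n : ℕ∞)

/-- The innermost runtime complexity function (with value `⊤` where the maximum does not exist). -/
noncomputable def innermostRC (R : TRS ar V) (n : ℕ) : ℕ∞ :=
  ⨆ (t : Term ar V) (_ : IsBasic R.defined t ∧ t.size ≤ n), derivationLength (InnermostRew R) t

end Rewriting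

/-! A quasi-precedence on the signature is a preorder on `F`: `g ≤ f` is read as "`f` is at least
`g` in the precedence", `g < f` is its strict part and `AntisymmRel (· ≤ ·) f g` the induced
equivalence. -/

/-- Admissible precedences, with `D` the set of defined symbols. -/
def Admissible {F : Type*} [Preorder F] (D : Set F) : Prop :=
  (∀ f g : F, g < f → g ∈ D → f ∈ D) ∧
    (∀ f g : F, AntisymmRel (· ≤ ·) f g → (f ∈ D ↔ g ∈ D))

/-- A safe mapping: it assigns to each symbol its set of safe argument positions; all argument
positions of constructors (the symbols outside `D`) are safe. -/
structure SafeMapping {F : Type*} (ar : F → ℕ) (D : Set F) where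
  safe : (f : F) → Finset (Fin (ar f))
  safe_constructor : ∀ f, f ∉ D → safe f = Finset.univ

/-- The weak multiset extension of the relation with strict part `gt` and equivalence `eqv`:
after cancelling equivalent elements pairwise, every remaining element of `N` is below some
remaining element of `M`. -/
def MulGE {α : Type*} (gt eqv : α → α → Prop) (M N : Multiset α) : Prop :=
  ∃ X Y Z W : Multiset α, M = X + Z ∧ N = Y + W ∧ Multiset.Rel eqv Z W ∧
    ∀ y ∈ Y, ∃ x ∈ X, gt x y

/-- The strict multiset extension: moreover at least one element of `M` is not cancelled. -/
def MulGT {α : Type*} (gt eqv : α → α → Prop) (M N : Multiset α) : Prop :=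
  ∃ X Y Z W : Multiset α, M = X + Z ∧ N = Y + W ∧ Multiset.Rel eqv Z W ∧ X ≠ 0 ∧
    ∀ y ∈ Y, ∃ x ∈ X, gt x y

section Orders

variable {F V : Type*} {ar : F → ℕ} {D : Set F}

/-- The multiset of safe arguments of `f(ss)`. -/
def SafeMapping.safeArgs (S : SafeMapping ar D) {f : F} (ss : Fin (ar f) → Term ar V) :
    Multiset (Term ar V) :=
  (S.safe f).val.map ss

/-- The multiset of normal arguments of `f(ss)`. -/
def SafeMapping.normalArgs (S : SafeMapping ar D) {f : F} (ss : Fin (ar f) → Term ar V) :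
    Multiset (Term ar V) :=
  (S.safe f)ᶜ.val.map ss

variable [Preorder F]

/-- Term equivalence respecting the separation of safe and normal argument positions. -/
inductive SafeEquiv (S : SafeMapping ar D) : Term ar V → Term ar V → Prop
  | refl (t : Term ar V) : SafeEquiv S t t
  | app (f g : F) (hfg : AntisymmRel (· ≤ ·) f g)
      (ss : Fin (ar f) → Term ar V) (ts : Fin (ar g) → Term ar V)
      (π : Fin (ar f) ≃ Fin (ar g)) (h : ∀ i, SafeEquiv S (ss i) (ts (π i)))
      (hsafe : ∀ i, i ∈ S.safe f ↔ π i ∈ S.safe g) :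
      SafeEquiv S (.app f ss) (.app g ts)

/-- The auxiliary order. The clause "some `s_i` is greater than or equivalent to `t`" is split
into two constructors. -/
inductive Gsq (S : SafeMapping ar D) : Term ar V → Term ar V → Prop
  | arg_gt (f : F) (ss : Fin (ar f) → Term ar V) (i : Fin (ar f)) (t : Term ar V)
      (hi : f ∈ D → i ∉ S.safe f) (h : Gsq S (ss i) t) : Gsq S (.app f ss) t
  | arg_equiv (f : F) (ss : Fin (ar f) → Term ar V) (i : Fin (ar f)) (t : Term ar V)
      (hi : f ∈ D → i ∉ S.safe f) (h : SafeEquiv S (ss i) t) : Gsq S (.app f ss) t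
  | prec (f g : F) (ss : Fin (ar f) → Term ar V) (ts : Fin (ar g) → Term ar V)
      (hfg : g < f) (hf : f ∈ D) (h : ∀ j, Gsq S (.app f ss) (ts j)) :
      Gsq S (.app f ss) (.app g ts)

/-- The polynomial path order `>pop*`. In the last constructor the relation `Q` stands for (a part
of) the order itself; since the multiset extensions are monotone, this is the clause with `Gpop S`
in place of `Q`, see `gpop_iff`. -/
inductive Gpop (S : SafeMapping ar D) : Term ar V → Term ar V → Prop
  | of_gsq (s t : Term ar V) (h : Gsq S s t) : Gpop S s t
  | arg_gt (f : F) (ss : Fin (ar f) → Term ar V) (i : Fin (ar f)) (t : Term ar V)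
      (h : Gpop S (ss i) t) : Gpop S (.app f ss) t
  | arg_equiv (f : F) (ss : Fin (ar f) → Term ar V) (i : Fin (ar f)) (t : Term ar V)
      (h : SafeEquiv S (ss i) t) : Gpop S (.app f ss) t
  | prec (f g : F) (ss : Fin (ar f) → Term ar V) (ts : Fin (ar g) → Term ar V)
      (hfg : g < f) (hf : f ∈ D) (j₀ : Fin (ar g)) (hj₀ : j₀ ∈ S.safe g)
      (h₀ : Gpop S (.app f ss) (ts j₀))
      (h : ∀ j, j ≠ j₀ → Gsq S (.app f ss) (ts j) ∨
        (ProperSubterm (ts j) (.app f ss) ∧ j ∈ S.safe g)) :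
      Gpop S (.app f ss) (.app g ts)
  | mul (f g : F) (ss : Fin (ar f) → Term ar V) (ts : Fin (ar g) → Term ar V)
      (hfg : AntisymmRel (· ≤ ·) f g)
      (Q : Term ar V → Term ar V → Prop) (hQ : ∀ a b, Q a b → Gpop S a b)
      (hn : MulGT Q (SafeEquiv S) (S.normalArgs ss) (S.normalArgs ts))
      (hs : MulGE Q (SafeEquiv S) (S.safeArgs ss) (S.safeArgs ts)) :
      Gpop S (.app f ss) (.app g ts)

/-- The defining equivalence of the polynomial path order, clause by clause. -/
theorem gpop_iff (S : SafeMapping ar D) (f : F) (ss : Fin (ar f) → Term ar V) (t : Term ar V) :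
    Gpop S (.app f ss) t ↔
      Gsq S (.app f ss) t ∨
      (∃ i, Gpop S (ss i) t ∨ SafeEquiv S (ss i) t) ∨
      (∃ (g : F) (ts : Fin (ar g) → Term ar V), t = .app g ts ∧ g < f ∧ f ∈ D ∧
        ∃ j₀ ∈ S.safe g, Gpop S (.app f ss) (ts j₀) ∧
          ∀ j, j ≠ j₀ → Gsq S (.app f ss) (ts j) ∨
            (ProperSubterm (ts j) (.app f ss) ∧ j ∈ S.safe g)) ∨
      (∃ (g : F) (ts : Fin (ar g) → Term ar V), t = .app g ts ∧ AntisymmRel (· ≤ ·) f g ∧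
        MulGT (Gpop S) (SafeEquiv S) (S.normalArgs ss) (S.normalArgs ts) ∧
        MulGE (Gpop S) (SafeEquiv S) (S.safeArgs ss) (S.safeArgs ts)) := by
  constructor
  · intro h
    cases h with
    | of_gsq _ _ h => exact Or.inl h
    | arg_gt _ _ i _ h => exact Or.inr (Or.inl ⟨i, Or.inl h⟩)
    | arg_equiv _ _ i _ h => exact Or.inr (Or.inl ⟨i, Or.inr h⟩)
    | prec _ g _ ts hfg hf j₀ hj₀ h₀ h =>
      exact Or.inr (Or.inr (Or.inl ⟨g, ts, rfl, hfg, hf, j₀, hj₀, h₀, h⟩))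
    | mul _ g _ ts hfg Q hQ hn hs =>
      obtain ⟨X, Y, Z, W, h1, h2, h3, h4, h5⟩ := hn
      obtain ⟨X', Y', Z', W', h1', h2', h3', h5'⟩ := hs
      refine Or.inr (Or.inr (Or.inr ⟨g, ts, rfl, hfg, ⟨X, Y, Z, W, h1, h2, h3, h4, ?_⟩,
        ⟨X', Y', Z', W', h1', h2', h3', ?_⟩⟩))
      · intro y hy
        obtain ⟨x, hx, hxy⟩ := h5 y hy
        exact ⟨x, hx, hQ _ _ hxy⟩
      · intro y hy
        obtain ⟨x, hx, hxy⟩ := h5' y hy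
        exact ⟨x, hx, hQ _ _ hxy⟩
  · rintro (h | ⟨i, h | h⟩ | ⟨g, ts, rfl, hfg, hf, j₀, hj₀, h₀, h⟩ | ⟨g, ts, rfl, hfg, hn, hs⟩)
    · exact .of_gsq _ _ h
    · exact .arg_gt _ _ i _ h
    · exact .arg_equiv _ _ i _ h
    · exact .prec _ _ _ _ hfg hf j₀ hj₀ h₀ h
    · exact .mul _ _ _ _ hfg (Gpop S) (fun _ _ h => h) hn hs

end Orders

end PopStar

/-! The measure is constructor depth, not size: safe subterms may be duplicated, so sizes can grow
exponentially, while depths combine by maxima. Normal forms need not be values; stuck calls count as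
atoms. On argument instances that are normal forms, both orders decrease depth and equivalence
preserves it (`Gpop.valueLT`, `SafeEquiv.valueEquiv`).

The invariant is `CallBound`: if the normal arguments have depth at most `n` and the safe ones at
most `m`, a call takes at most `p(n)` steps and its result has depth at most `m + p(n)`. The step
count ignores `m`, and `m` enters the depth with coefficient one, so nesting calls in safe positions
adds costs instead of composing them.

The invariant is proved by induction on the precedence. A right-hand side contains at most one
recursive call, with cost `a` and depth growth `b`; the rest consists of calls to lower symbols. Its
cost is therefore at most `a + q(n)` and its growth at most `b + q(n)` (`Gpop.exists_bound`). Each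
recursive call lowers the multiset of normal argument depths. With entries at most `n` and at most
`K` elements, there are at most `(n+2)^K` such multisets, so polynomially many increments `q(n) + 1`
are summed (`exists_callBound_of_lower`). -/

namespace PopStar

/-! ### Constructor depth and bounds for innermost derivations -/

section Bounds

variable {F V : Type*} {ar : F → ℕ}

open Classical in
/-- The nesting depth of constructors; variables and terms with a root in `D` count as atoms. -/
noncomputable def Term.depth (D : Set F) : Term ar V → ℕ
  | .var _ => 0
  | .app f ts => if f ∈ D then 0 else 1 + Finset.univ.sup fun i => (ts i).depth D

theorem Term.depth_app_of_mem {D : Set F} {f : F} (hf : f ∈ D) (ts : Fin (ar f) → Term ar V) :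
    (Term.app f ts).depth D = 0 := by
  simp [Term.depth, hf]

theorem Term.depth_app_of_notMem {D : Set F} {f : F} (hf : f ∉ D)
    (ts : Fin (ar f) → Term ar V) :
    (Term.app f ts).depth D = 1 + Finset.univ.sup fun i => (ts i).depth D := by
  simp [Term.depth, hf]

theorem Term.depth_arg_lt {D : Set F} {f : F} (hf : f ∉ D) (ts : Fin (ar f) → Term ar V)
    (i : Fin (ar f)) : (ts i).depth D < (Term.app f ts).depth D := by
  rw [Term.depth_app_of_notMem hf]
  have := Finset.le_sup (f := fun i => (ts i).depth D) (Finset.mem_univ i)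
  omega

theorem Term.depth_app_le {D : Set F} (f : F) (ts : Fin (ar f) → Term ar V) (d : ℕ)
    (h : ∀ i, (ts i).depth D ≤ d) : (Term.app f ts).depth D ≤ d + 1 := by
  by_cases hf : f ∈ D
  · simp [Term.depth_app_of_mem hf]
  · rw [Term.depth_app_of_notMem hf, add_comm]
    exact Nat.succ_le_succ (Finset.sup_le fun i _ => h i)

theorem Term.depth_le_size (D : Set F) (t : Term ar V) : t.depth D ≤ t.size := by
  induction t with
  | var x => simp [Term.depth]
  | app f ts ih =>
    rw [Term.size, add_comm]
    exact Term.depth_app_le f ts _ fun i => (ih i).trans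
      (Finset.single_le_sum (f := fun i => (ts i).size) (fun _ _ => Nat.zero_le _)
        (Finset.mem_univ i))

variable {R : TRS ar V}

theorem InnermostRew.rew {s t : Term ar V} (h : InnermostRew R s t) : Rew R s t := by
  induction h with
  | root l r h σ _ => exact .root l r h σ
  | arg f ts i _ ih => exact .arg f ts i ih

theorem normalForm_var (x : V) : NormalForm R (.var x) := by
  intro u h
  generalize hs : Term.var x = s at h
  cases h with
  | root l r h σ =>
    cases l with
    | var y => exact R.lhs_not_var _ _ h y rfl
    | app f ts => simp [Term.subst] at hs
  | arg f ts i h => simp at hs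

theorem NormalForm.arg {f : F} {ts : Fin (ar f) → Term ar V}
    (h : NormalForm R (.app f ts)) (i : Fin (ar f)) : NormalForm R (ts i) :=
  fun _ hu => h _ (.arg f ts i hu)

theorem normalForm_app {f : F} (hf : f ∉ R.defined) {ts : Fin (ar f) → Term ar V}
    (h : ∀ i, NormalForm R (ts i)) : NormalForm R (.app f ts) := by
  intro u hu
  generalize hs : Term.app f ts = s at hu
  cases hu with
  | root l r hlr σ =>
    cases l with
    | var y => exact R.lhs_not_var _ _ hlr y rfl
    | app g ls =>
      obtain ⟨rfl, -⟩ := Term.app.inj hs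
      exact hf ⟨ls, r, hlr⟩
  | arg g us i hi =>
    obtain ⟨rfl, h'⟩ := Term.app.inj hs
    obtain rfl := eq_of_heq h'
    exact h i _ hi

theorem IsValue.normalForm {t : Term ar V} (ht : IsValue R.defined t) : NormalForm R t := by
  induction t with
  | var x => exact normalForm_var x
  | app f ts ih => exact normalForm_app ht.1 fun i => ih i (ht.2 i)

theorem TRS.finite_defined (R : TRS ar V) : R.defined.Finite := by
  classical
  cases isEmpty_or_nonempty F with
  | inl h => exact Set.toFinite _
  | inr h =>
    obtain ⟨f₀⟩ := h
    refine (R.finite_rules.image fun p => match p.1 with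
      | .var _ => f₀
      | .app f _ => f).subset ?_
    rintro f ⟨ts, r, h⟩
    exact ⟨_, h, rfl⟩

/-- Every innermost derivation from `t` has length at most `c`, and every normal form it reaches
has depth at most `d`. -/
def Bounded (R : TRS ar V) (t : Term ar V) (c d : ℕ) : Prop :=
  ∀ k u, StepsN (InnermostRew R) k t u → k ≤ c ∧ (NormalForm R u → u.depth R.defined ≤ d)

theorem Bounded.mono {t : Term ar V} {c d c' d' : ℕ} (h : Bounded R t c d) (hc : c ≤ c')
    (hd : d ≤ d') : Bounded R t c' d' :=
  fun k u hk => ⟨(h k u hk).1.trans hc, fun hu => ((h k u hk).2 hu).trans hd⟩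

theorem NormalForm.bounded {t : Term ar V} (ht : NormalForm R t) {d : ℕ}
    (hd : t.depth R.defined ≤ d) : Bounded R t 0 d := by
  intro k u hk
  cases k with
  | zero => cases hk; exact ⟨le_rfl, fun _ => hd⟩
  | succ k => obtain ⟨c, hc, -⟩ := hk; exact absurd hc.rew (ht c)

theorem Bounded.of_step {t : Term ar V} {c d : ℕ} (hd : t.depth R.defined ≤ d)
    (h : ∀ u, InnermostRew R t u → Bounded R u c d) : Bounded R t (c + 1) d := by
  intro k u hk
  cases k with
  | zero => cases hk; exact ⟨Nat.zero_le _, fun _ => hd⟩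
  | succ k =>
    obtain ⟨v, hv, hk⟩ := hk
    exact ⟨Nat.succ_le_succ (h v hv k u hk).1, (h v hv k u hk).2⟩

/-- An innermost derivation first rewrites below the root; a step at the root needs all arguments
to be normalised. -/
theorem StepsN.decompose {f : F} {k : ℕ} {ts : Fin (ar f) → Term ar V} {u : Term ar V}
    (h : StepsN (InnermostRew R) k (.app f ts) u) :
    ∃ (us : Fin (ar f) → Term ar V) (ks : Fin (ar f) → ℕ) (k' : ℕ),
      (∀ i, StepsN (InnermostRew R) (ks i) (ts i) (us i)) ∧
      StepsN (InnermostRew R) k' (.app f us) u ∧ k = ∑ i, ks i + k' ∧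
      (k' = 0 ∨ (f ∈ R.defined ∧ ∀ i, NormalForm R (us i))) := by
  induction k generalizing ts with
  | zero => exact ⟨ts, 0, 0, fun i => rfl, h, by simp, .inl rfl⟩
  | succ k ih =>
    obtain ⟨v, hv, hk⟩ := id h
    generalize hs : Term.app f ts = s at hv
    cases hv with
    | root l r hlr σ hnf =>
      cases l with
      | var y => exact absurd rfl (R.lhs_not_var _ _ hlr y)
      | app g ls =>
        rw [← hs] at hnf
        obtain ⟨rfl, -⟩ := Term.app.inj hs
        exact ⟨ts, 0, k + 1, fun i => rfl, h, by simp,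
          .inr ⟨⟨ls, r, hlr⟩, fun i => hnf _ (.arg _ _ i)⟩⟩
    | @arg g us i w hi =>
      obtain ⟨rfl, h'⟩ := Term.app.inj hs
      obtain rfl := eq_of_heq h'
      obtain ⟨us, ks, k', h1, h2, h3, h4⟩ := ih hk
      -- The first step is charged to argument `i`.
      refine ⟨us, ks + Pi.single i 1, k', fun j => ?_, h2, ?_, h4⟩
      · have := h1 j
        by_cases hj : j = i
        · subst hj
          rw [Function.update_self] at this
          simpa using ⟨w, hi, this⟩
        · rw [Function.update_of_ne hj] at this
          simpa [hj] using this
      · simp [Finset.sum_add_distrib, h3]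
        omega

theorem Bounded.app_constructor {f : F} (hf : f ∉ R.defined) {ts : Fin (ar f) → Term ar V}
    {c : Fin (ar f) → ℕ} {d : ℕ} (h : ∀ i, Bounded R (ts i) (c i) d) :
    Bounded R (.app f ts) (∑ i, c i) (d + 1) := by
  intro k u hk
  obtain ⟨us, ks, k', h1, h2, rfl, h4⟩ := hk.decompose
  obtain rfl := h4.resolve_right fun h => hf h.1
  obtain rfl : Term.app f us = u := h2
  exact ⟨by simpa using Finset.sum_le_sum fun i _ => (h i _ _ (h1 i)).1,
    fun hu => Term.depth_app_le _ _ _ fun i => (h i _ _ (h1 i)).2 (hu.arg i)⟩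

/-- A root step requires normalised arguments, so the argument costs and the cost of one call on
normal forms add up. -/
theorem Bounded.app_of_call {f : F} {ts : Fin (ar f) → Term ar V} {c d : Fin (ar f) → ℕ}
    {C e : ℕ} (h : ∀ i, Bounded R (ts i) (c i) (d i))
    (hcall : ∀ us : Fin (ar f) → Term ar V, (∀ i, NormalForm R (us i)) →
      (∀ i, (us i).depth R.defined ≤ d i) → Bounded R (.app f us) C e) :
    Bounded R (.app f ts) (∑ i, c i + C) e := by
  intro k u hk
  obtain ⟨us, ks, k', h1, h2, rfl, h4⟩ := hk.decompose
  have hsum : ∑ i, ks i ≤ ∑ i, c i := Finset.sum_le_sum fun i _ => (h i _ _ (h1 i)).1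
  have key : (∀ i, NormalForm R (us i)) → Bounded R (.app f us) C e := fun hus =>
    hcall us hus fun i => (h i _ _ (h1 i)).2 (hus i)
  rcases h4 with rfl | h4
  -- Without steps after the argument phase, a normal `u` has normal arguments, so the call bound
  -- applies to the empty derivation.
  · refine ⟨by omega, fun hu => ?_⟩
    have h2' : Term.app f us = u := h2
    exact (key (fun i => NormalForm.arg (h2' ▸ hu) i) 0 u h2).2 hu
  · have := key h4.2 k' u h2
    exact ⟨by omega, this.2⟩

end Bounds

/-! ### Counting bounded multisets below a given one -/

section Counting

/-- The multisets over `{0, …, n}` with at most `k` elements. -/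
def boundedMultisets (n : ℕ) : ℕ → Finset (Multiset ℕ)
  | 0 => {0}
  | k + 1 => boundedMultisets n k ∪
      (Finset.range (n + 1) ×ˢ boundedMultisets n k).image fun p => p.1 ::ₘ p.2

theorem card_boundedMultisets_le (n k : ℕ) : (boundedMultisets n k).card ≤ (n + 2) ^ k := by
  induction k with
  | zero => simp [boundedMultisets]
  | succ k ih =>
    calc _ ≤ (boundedMultisets n k).card + (n + 1) * (boundedMultisets n k).card := by
          refine (Finset.card_union_le _ _).trans (Nat.add_le_add_left ?_ _)
          refine Finset.card_image_le.trans ?_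
          simp
      _ = (n + 2) * (boundedMultisets n k).card := by ring
      _ ≤ (n + 2) * (n + 2) ^ k := Nat.mul_le_mul_left _ ih
      _ = _ := by ring

theorem mem_boundedMultisets {n k : ℕ} {M : Multiset ℕ} (hM : ∀ x ∈ M, x ≤ n)
    (hk : Multiset.card M ≤ k) : M ∈ boundedMultisets n k := by
  induction k generalizing M with
  | zero =>
    obtain rfl := Multiset.card_eq_zero.1 (Nat.le_zero.1 hk)
    simp [boundedMultisets]
  | succ k ih =>
    induction M using Multiset.induction with
    | empty => exact Finset.mem_union_left _ (ih hM (by simp))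
    | cons a M _ =>
      refine Finset.mem_union_right _ (Finset.mem_image.2 ⟨(a, M), ?_, rfl⟩)
      simp only [Finset.mem_product, Finset.mem_range]
      exact ⟨Nat.lt_succ_of_le (hM a (by simp)),
        ih (fun x hx => hM x (by simp [hx])) (by simpa using hk)⟩

open Classical in
/-- The number of multisets over `{0, …, n}` with at most `k` elements below `M`. -/
noncomputable def multisetRank (n k : ℕ) (M : Multiset ℕ) : ℕ :=
  ((boundedMultisets n k).filter fun N : Multiset ℕ => N.IsDershowitzMannaLT M).card

theorem multisetRank_le (n k : ℕ) (M : Multiset ℕ) : multisetRank n k M ≤ (n + 2) ^ k := by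
  classical
  exact (Finset.card_filter_le _ _).trans (card_boundedMultisets_le n k)

/-- By transitivity everything below `N` is below `M`; by irreflexivity `N` itself is counted only
for `M`. -/
theorem multisetRank_lt {n k : ℕ} {M N : Multiset ℕ} (hN : ∀ x ∈ N, x ≤ n)
    (hk : Multiset.card N ≤ k) (h : N.IsDershowitzMannaLT M) :
    multisetRank n k N < multisetRank n k M := by
  classical
  refine Finset.card_lt_card (Finset.ssubset_iff_of_subset ?_ |>.2 ⟨N, ?_, ?_⟩)
  · intro P hP
    rw [Finset.mem_filter] at hP ⊢
    exact ⟨hP.1, hP.2.trans h⟩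
  · exact Finset.mem_filter.2 ⟨mem_boundedMultisets hN hk, h⟩
  · intro hP
    exact Multiset.wellFounded_isDershowitzMannaLT.irrefl.irrefl N (Finset.mem_filter.1 hP).2

end Counting

/-! ### The orders on values, compared with depth -/

section Values

variable {F V : Type*} {ar : F → ℕ} {R : TRS ar V}

/-- `t` is a value each of whose normalised instances is normalised, with depth strictly below the
depth of the corresponding instance of `s`. -/
def ValueLT (R : TRS ar V) (s t : Term ar V) : Prop :=
  IsValue R.defined t ∧ ∀ σ, NormalForm R (s.subst σ) → NormalForm R (t.subst σ) ∧
    (t.subst σ).depth R.defined < (s.subst σ).depth R.defined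

/-- The analogue of `ValueLT` for equal depths. -/
def ValueEquiv (R : TRS ar V) (s t : Term ar V) : Prop :=
  IsValue R.defined t ∧ ∀ σ, NormalForm R (s.subst σ) → NormalForm R (t.subst σ) ∧
    (t.subst σ).depth R.defined = (s.subst σ).depth R.defined

theorem ValueLT.app {f : F} (hf : f ∉ R.defined) {ss : Fin (ar f) → Term ar V}
    {i : Fin (ar f)} {t : Term ar V} (h : ValueLT R (ss i) t) : ValueLT R (.app f ss) t :=
  ⟨h.1, fun σ hσ => ⟨(h.2 σ (hσ.arg i)).1, (h.2 σ (hσ.arg i)).2.trans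
    (Term.depth_arg_lt hf (fun i => (ss i).subst σ) i)⟩⟩

theorem ValueEquiv.app {f : F} (hf : f ∉ R.defined) {ss : Fin (ar f) → Term ar V}
    {i : Fin (ar f)} {t : Term ar V} (h : ValueEquiv R (ss i) t) : ValueLT R (.app f ss) t :=
  ⟨h.1, fun σ hσ => ⟨(h.2 σ (hσ.arg i)).1, (h.2 σ (hσ.arg i)).2.trans_lt
    (Term.depth_arg_lt hf (fun i => (ss i).subst σ) i)⟩⟩

theorem IsValue.refl_equiv {s : Term ar V} (h : IsValue R.defined s) : ValueEquiv R s s :=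
  ⟨h, fun _ hσ => ⟨hσ, rfl⟩⟩

theorem IsValue.properSubterm {s u : Term ar V} (hs : IsValue R.defined s)
    (h : ProperSubterm u s) : ValueLT R s u := by
  induction h with
  | arg f ss i => exact (hs.2 i).refl_equiv.app hs.1
  | deep f ss i _ ih => exact (ih (hs.2 i)).app hs.1

variable [Preorder F] {S : SafeMapping ar R.defined}

theorem SafeEquiv.valueEquiv (hadm : Admissible R.defined) {s t : Term ar V}
    (h : SafeEquiv S s t) (hs : IsValue R.defined s) : ValueEquiv R s t := by
  induction h with
  | refl t => exact hs.refl_equiv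
  | app f g hfg ss ts π _ _ ih =>
    have hg : g ∉ R.defined := fun hg => hs.1 ((hadm.2 f g hfg).2 hg)
    have ih' : ∀ j, ValueEquiv R (ss (π.symm j)) (ts j) := fun j => by
      simpa using ih (π.symm j) (hs.2 _)
    refine ⟨⟨hg, fun j => (ih' j).1⟩, fun σ hσ => ⟨?_, ?_⟩⟩
    · exact normalForm_app hg fun j => ((ih' j).2 σ (hσ.arg _)).1
    · rw [Term.subst, Term.subst, Term.depth_app_of_notMem hg, Term.depth_app_of_notMem hs.1]
      congr 1
      apply le_antisymm <;> refine Finset.sup_le fun i _ => ?_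
      · rw [((ih' i).2 σ (hσ.arg _)).2]
        exact Finset.le_sup (f := fun i => ((ss i).subst σ).depth R.defined) (Finset.mem_univ _)
      · rw [← ((ih i (hs.2 i)).2 σ (hσ.arg _)).2]
        exact Finset.le_sup (f := fun i => ((ts i).subst σ).depth R.defined) (Finset.mem_univ _)

theorem Gsq.valueLT (hadm : Admissible R.defined) {s t : Term ar V}
    (h : Gsq S s t) (hs : IsValue R.defined s) : ValueLT R s t := by
  induction h with
  | arg_gt f ss i t _ _ ih => exact (ih (hs.2 i)).app hs.1
  | arg_equiv f ss i t _ h => exact (h.valueEquiv hadm (hs.2 i)).app hs.1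
  | prec f g ss ts _ hf => exact absurd hf hs.1

/-- A value has a constructor root, so only the argument clauses survive: precedence descent needs a
defined root, and the multiset clause needs a normal argument. -/
theorem Gpop.valueLT (hadm : Admissible R.defined) {s t : Term ar V}
    (h : Gpop S s t) (hs : IsValue R.defined s) : ValueLT R s t := by
  induction h with
  | of_gsq s t h => exact h.valueLT hadm hs
  | arg_gt f ss i t _ ih => exact (ih (hs.2 i)).app hs.1
  | arg_equiv f ss i t h => exact (h.valueEquiv hadm (hs.2 i)).app hs.1
  | prec f g ss ts _ hf => exact absurd hf hs.1
  | mul f g ss ts _ Q _ hn =>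
    obtain ⟨X, Y, Z, W, h1, -, -, h4, -⟩ := hn
    have : S.normalArgs ss = 0 := by simp [SafeMapping.normalArgs, S.safe_constructor f hs.1]
    rw [this] at h1
    exact absurd (add_eq_zero.1 h1.symm).1 h4

end Values

/-! ### Polynomial bounds for calls -/

section Calls

variable {F V : Type*} {ar : F → ℕ} {R : TRS ar V}

/-- The arguments are normal forms, with depth at most `n` at normal and at most `m` at safe
positions. -/
structure ArgsBounded (S : SafeMapping ar R.defined) {f : F} (us : Fin (ar f) → Term ar V)
    (n m : ℕ) : Prop where
  normalForm : ∀ i, NormalForm R (us i)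
  normal : ∀ i, i ∉ S.safe f → (us i).depth R.defined ≤ n
  safe : ∀ i, i ∈ S.safe f → (us i).depth R.defined ≤ m

/-- The multiset of depths of the normal arguments. -/
noncomputable def normalDepths (S : SafeMapping ar R.defined) {f : F}
    (us : Fin (ar f) → Term ar V) : Multiset ℕ :=
  (S.normalArgs us).map (Term.depth R.defined)

theorem card_normalDepths_le {f : F} (S : SafeMapping ar R.defined) (us : Fin (ar f) → Term ar V) :
    Multiset.card (normalDepths S us) ≤ ar f := by
  simpa [normalDepths, SafeMapping.normalArgs] using Finset.card_le_univ (S.safe f)ᶜ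

/-- Calls of `f` are bounded by `p` in the depth of the normal arguments, up to a summand for the
depth of the safe arguments in the depth of the result. -/
def CallBound (S : SafeMapping ar R.defined) (f : F) (p : Polynomial ℕ) : Prop :=
  ∀ (us : Fin (ar f) → Term ar V) (n m : ℕ), ArgsBounded S us n m →
    Bounded R (.app f us) (p.eval n) (m + p.eval n)

variable {S : SafeMapping ar R.defined}

theorem ArgsBounded.depth_le {f : F} {us : Fin (ar f) → Term ar V} {n m : ℕ}
    (h : ArgsBounded S us n m) (i : Fin (ar f)) : (us i).depth R.defined ≤ m + n := by
  by_cases hi : i ∈ S.safe f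
  · exact (h.safe i hi).trans (Nat.le_add_right _ _)
  · exact (h.normal i hi).trans (Nat.le_add_left _ _)

theorem CallBound.mono {f : F} {p q : Polynomial ℕ} (h : CallBound S f p)
    (hpq : ∀ n : ℕ, p.eval n ≤ q.eval n) : CallBound S f q :=
  fun us n m hus => (h us n m hus).mono (hpq n) (Nat.add_le_add_left (hpq n) m)

theorem ValueLT.bounded {s t : Term ar V} (h : ValueLT R s t) {σ : V → Term ar V}
    (hs : NormalForm R (s.subst σ)) {d : ℕ} (hd : (s.subst σ).depth R.defined ≤ d) :
    Bounded R (t.subst σ) 0 d :=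
  (h.2 σ hs).1.bounded ((h.2 σ hs).2.le.trans hd)

theorem ValueEquiv.bounded {s t : Term ar V} (h : ValueEquiv R s t) {σ : V → Term ar V}
    (hs : NormalForm R (s.subst σ)) {d : ℕ} (hd : (s.subst σ).depth R.defined ≤ d) :
    Bounded R (t.subst σ) 0 d :=
  (h.2 σ hs).1.bounded ((h.2 σ hs).2.le.trans hd)

theorem MulGE.normalForm_depth_le [Preorder F] (hadm : Admissible R.defined)
    {Q : Term ar V → Term ar V → Prop} (hQ : ∀ a b, Q a b → Gpop S a b)
    {M N : Multiset (Term ar V)} (h : MulGE Q (SafeEquiv S) M N) {σ : V → Term ar V} {n : ℕ}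
    (hM : ∀ s ∈ M, IsValue R.defined s ∧ NormalForm R (s.subst σ) ∧
      (s.subst σ).depth R.defined ≤ n) :
    ∀ t ∈ N, NormalForm R (t.subst σ) ∧ (t.subst σ).depth R.defined ≤ n := by
  obtain ⟨X, Y, Z, W, rfl, rfl, h3, h4⟩ := h
  intro t ht
  rcases Multiset.mem_add.1 ht with ht | ht
  · obtain ⟨s, hs, hst⟩ := h4 t ht
    obtain ⟨hv, hnf, hd⟩ := hM s (Multiset.mem_add.2 (.inl hs))
    have := ((hQ _ _ hst).valueLT hadm hv).2 σ hnf
    exact ⟨this.1, this.2.le.trans hd⟩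
  · obtain ⟨s, hs, hst⟩ := Multiset.exists_mem_of_rel_of_mem (Multiset.rel_flip.2 h3) ht
    obtain ⟨hv, hnf, hd⟩ := hM s (Multiset.mem_add.2 (.inr hs))
    have := (SafeEquiv.valueEquiv hadm hst hv).2 σ hnf
    exact ⟨this.1, this.2.le.trans hd⟩

theorem MulGT.mulGE {α : Type*} {gt eqv : α → α → Prop} {M N : Multiset α}
    (h : MulGT gt eqv M N) : MulGE gt eqv M N := by
  obtain ⟨X, Y, Z, W, h1, h2, h3, -, h5⟩ := h
  exact ⟨X, Y, Z, W, h1, h2, h3, h5⟩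

/-- Equivalent pairs have equal depth and become the common part; the remaining elements strictly
decrease in depth. -/
theorem MulGT.isDershowitzMannaLT [Preorder F] (hadm : Admissible R.defined)
    {Q : Term ar V → Term ar V → Prop} (hQ : ∀ a b, Q a b → Gpop S a b)
    {M N : Multiset (Term ar V)} (h : MulGT Q (SafeEquiv S) M N) {σ : V → Term ar V}
    (hM : ∀ s ∈ M, IsValue R.defined s ∧ NormalForm R (s.subst σ)) :
    (N.map fun t => (t.subst σ).depth R.defined).IsDershowitzMannaLT
      (M.map fun s => (s.subst σ).depth R.defined) := by
  obtain ⟨X, Y, Z, W, rfl, rfl, h3, h4, h5⟩ := h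
  have hZW : Z.map (fun s => (s.subst σ).depth R.defined) =
      W.map fun t => (t.subst σ).depth R.defined := by
    rw [← Multiset.rel_eq, Multiset.rel_map]
    refine h3.mono fun s hs t _ hst => ?_
    obtain ⟨hv, hnf⟩ := hM s (Multiset.mem_add.2 (.inr hs))
    exact ((hst.valueEquiv hadm hv).2 σ hnf).2.symm
  refine ⟨W.map fun t => (t.subst σ).depth R.defined, Y.map fun t => (t.subst σ).depth R.defined,
    X.map fun t => (t.subst σ).depth R.defined, ?_, ?_, ?_, ?_⟩
  · simpa using h4
  · rw [Multiset.map_add, add_comm]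
  · rw [Multiset.map_add, hZW, add_comm]
  · intro y hy
    obtain ⟨t, ht, rfl⟩ := Multiset.mem_map.1 hy
    obtain ⟨s, hs, hst⟩ := h5 t ht
    obtain ⟨hv, hnf⟩ := hM s (Multiset.mem_add.2 (.inl hs))
    exact ⟨_, Multiset.mem_map_of_mem _ hs, (((hQ _ _ hst).valueLT hadm hv).2 σ hnf).2⟩

/-- Cost of a term `g(ts)` all of whose arguments are bounded, where the bounds at normal positions
do not depend on the safe inputs. -/
theorem Bounded.app {g : F} {p : Polynomial ℕ} (hp : g ∈ R.defined → CallBound S g p)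
    {ts : Fin (ar g) → Term ar V} {c e : Fin (ar g) → ℕ} {a : ℕ}
    (h : ∀ j, Bounded R (ts j) (c j) (a + e j))
    (hn : ∀ j, j ∉ S.safe g → Bounded R (ts j) (c j) (e j)) :
    Bounded R (.app g ts) (∑ j, c j + p.eval (∑ j, e j))
      (a + (∑ j, e j + p.eval (∑ j, e j) + 1)) := by
  have hle : ∀ j, e j ≤ ∑ j, e j := fun j =>
    Finset.single_le_sum (fun _ _ => Nat.zero_le _) (Finset.mem_univ j)
  by_cases hg : g ∈ R.defined
  · classical
    -- The summand `a` is kept out of the normal positions, since `p` is evaluated at their bound.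
    refine Bounded.app_of_call
      (d := fun j => if j ∈ S.safe g then a + e j else e j) (fun j => ?_) fun us hus hd => ?_
    · split_ifs with hj
      exacts [h j, hn j hj]
    · refine (hp hg us (∑ j, e j) (a + ∑ j, e j) ⟨hus, fun j hj => ?_, fun j hj => ?_⟩).mono
        le_rfl (by omega)
      · have := hd j
        rw [if_neg hj] at this
        exact this.trans (hle j)
      · have := hd j
        rw [if_pos hj] at this
        exact this.trans (Nat.add_le_add_left (hle j) a)
  · exact (Bounded.app_constructor hg fun j =>
      (h j).mono le_rfl (Nat.add_le_add_left (hle j) a)).mono (by omega) (by omega)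

variable [Preorder F]

/-- Only normal arguments and calls to lower symbols are reachable, so neither bound depends on `m`.
Such terms may therefore fill normal positions. -/
theorem Gsq.exists_bound (hadm : Admissible R.defined) {f : F} {ls : Fin (ar f) → Term ar V}
    (hf : f ∈ R.defined) (hls : ∀ i, IsValue R.defined (ls i)) {p : Polynomial ℕ}
    (hp : ∀ g ∈ R.defined, g < f → CallBound S g p) {t : Term ar V}
    (h : Gsq S (.app f ls) t) :
    ∃ q : Polynomial ℕ, ∀ (σ : V → Term ar V) (n m : ℕ),
      ArgsBounded S (fun i => (ls i).subst σ) n m →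
        Bounded R (t.subst σ) (q.eval n) (q.eval n) := by
  generalize hs : Term.app f ls = s at h
  induction h with
  | arg_gt f' ss i t hi h =>
    obtain ⟨rfl, h'⟩ := Term.app.inj hs
    obtain rfl := eq_of_heq h'
    refine ⟨.X, fun σ n m hσ => ?_⟩
    exact ((h.valueLT hadm (hls i)).bounded (hσ.normalForm i) (hσ.normal i (hi hf))).mono
      (Nat.zero_le _) (by simp)
  | arg_equiv f' ss i t hi h =>
    obtain ⟨rfl, h'⟩ := Term.app.inj hs
    obtain rfl := eq_of_heq h'
    refine ⟨.X, fun σ n m hσ => ?_⟩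
    exact ((h.valueEquiv hadm (hls i)).bounded (hσ.normalForm i) (hσ.normal i (hi hf))).mono
      (Nat.zero_le _) (by simp)
  | prec f' g ss ts hfg _ _ ih =>
    obtain ⟨rfl, h'⟩ := Term.app.inj hs
    obtain rfl := eq_of_heq h'
    choose q hq using fun j => ih j rfl
    -- The three summands pay for the arguments, the call of `g`, and a possible constructor at the
    -- root.
    refine ⟨∑ j, q j + p.comp (∑ j, q j) + 1, fun σ n m hσ => ?_⟩
    have := Bounded.app (a := 0) (fun hg => hp g hg hfg) (fun j => by simpa using hq j σ n m hσ)
      (fun j _ => hq j σ n m hσ)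
    refine this.mono ?_ ?_ <;>
    simp [Polynomial.eval_comp, Polynomial.eval_finsetSum]

/-- The polynomial `q` is fixed before `a` and `b`, which enter with coefficient one: the precedence
clause passes the full order on to a single safe argument. -/
theorem Gpop.exists_bound (hadm : Admissible R.defined) {f : F} {ls : Fin (ar f) → Term ar V}
    (hf : f ∈ R.defined) (hls : ∀ i, IsValue R.defined (ls i)) {p : Polynomial ℕ}
    (hp : ∀ g ∈ R.defined, g < f → CallBound S g p) {t : Term ar V}
    (h : Gpop S (.app f ls) t) :
    ∃ q : Polynomial ℕ, ∀ (σ : V → Term ar V) (n m a b : ℕ),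
      ArgsBounded S (fun i => (ls i).subst σ) n m →
      (∀ (g : F) (us : Fin (ar g) → Term ar V), AntisymmRel (· ≤ ·) f g →
        ArgsBounded S us n m →
        (normalDepths S us).IsDershowitzMannaLT (normalDepths S fun i => (ls i).subst σ) →
        Bounded R (.app g us) a (m + b)) →
      Bounded R (t.subst σ) (a + q.eval n) (m + b + q.eval n) := by
  generalize hs : Term.app f ls = s at h
  induction h with
  | of_gsq s t h =>
    subst hs
    obtain ⟨q, hq⟩ := h.exists_bound hadm hf hls hp
    exact ⟨q, fun σ n m a b hσ _ => (hq σ n m hσ).mono (by omega) (by omega)⟩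
  | arg_gt f' ss i t h =>
    obtain ⟨rfl, h'⟩ := Term.app.inj hs
    obtain rfl := eq_of_heq h'
    refine ⟨.X, fun σ n m a b hσ _ => ?_⟩
    exact ((h.valueLT hadm (hls i)).bounded (hσ.normalForm i) (hσ.depth_le i)).mono
      (Nat.zero_le _) (by simp)
  | arg_equiv f' ss i t h =>
    obtain ⟨rfl, h'⟩ := Term.app.inj hs
    obtain rfl := eq_of_heq h'
    refine ⟨.X, fun σ n m a b hσ _ => ?_⟩
    exact ((h.valueEquiv hadm (hls i)).bounded (hσ.normalForm i) (hσ.depth_le i)).mono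
      (Nat.zero_le _) (by simp)
  | prec f' g ss ts hfg _ j₀ hj₀ _ h ih =>
    obtain ⟨rfl, h'⟩ := Term.app.inj hs
    obtain rfl := eq_of_heq h'
    obtain ⟨q₀, hq₀⟩ := ih rfl
    have hq : ∀ j, ∃ q : Polynomial ℕ, j ≠ j₀ → ∀ (σ : V → Term ar V) (n m : ℕ),
        ArgsBounded S (fun i => (ls i).subst σ) n m →
        Bounded R ((ts j).subst σ) (q.eval n) (m + q.eval n) ∧
        (j ∉ S.safe g → Bounded R ((ts j).subst σ) (q.eval n) (q.eval n)) := by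
      intro j
      by_cases hj : j = j₀
      · exact ⟨0, fun h => absurd hj h⟩
      rcases h j hj with h | ⟨h, hs⟩
      · obtain ⟨q, hq⟩ := h.exists_bound hadm hf hls hp
        exact ⟨q, fun _ σ n m hσ => ⟨(hq σ n m hσ).mono le_rfl (Nat.le_add_left _ _),
          fun _ => hq σ n m hσ⟩⟩
      · refine ⟨.X, fun _ σ n m hσ => ⟨?_, fun h => absurd hs h⟩⟩
        generalize ts j = u at h
        have : ∃ i, ValueLT R (ls i) u ∨ ValueEquiv R (ls i) u := by
          cases h with
          | arg _ _ i => exact ⟨i, .inr (hls i).refl_equiv⟩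
          | deep _ _ i h => exact ⟨i, .inl ((hls i).properSubterm h)⟩
        obtain ⟨i, h | h⟩ := this
        all_goals
          exact (h.bounded (hσ.normalForm i) (hσ.depth_le i)).mono (Nat.zero_le _) (by simp)
    choose q hq using hq
    classical
    refine ⟨∑ j, Function.update q j₀ q₀ j + p.comp (∑ j, Function.update q j₀ q₀ j) + 1,
      fun σ n m a b hσ hrec => ?_⟩
    have := Bounded.app (R := R) (S := S) (p := p) (a := m + b)
      (ts := fun j => (ts j).subst σ)
      -- The cost `a` of recursion is charged once, at `j₀`.
      (c := fun j => Pi.single (M := fun _ => ℕ) j₀ a j + (Function.update q j₀ q₀ j).eval n)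
      (e := fun j => (Function.update q j₀ q₀ j).eval n) (fun hg => hp g hg hfg)
      (fun j => ?_) (fun j hj => ?_)
    · refine this.mono ?_ ?_ <;>
      simp [Polynomial.eval_comp, Polynomial.eval_finsetSum, Finset.sum_add_distrib]
      all_goals omega
    · by_cases hj : j = j₀
      · subst hj
        simpa using hq₀ σ n m a b hσ hrec
      · simpa [hj] using (hq j hj σ n m hσ).1.mono le_rfl (by omega)
    · have hj' : j ≠ j₀ := fun h => hj (h ▸ hj₀)
      simpa [hj'] using (hq j hj' σ n m hσ).2 hj
  | mul f' g ss ts hfg Q hQ hn hm =>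
    obtain ⟨rfl, h'⟩ := Term.app.inj hs
    obtain rfl := eq_of_heq h'
    -- The instance is itself a recursive call on normalised arguments, so `hrec` gives the whole
    -- bound.
    refine ⟨0, fun σ n m a b hσ hrec => ?_⟩
    have hnormal : ∀ s ∈ S.normalArgs ls, IsValue R.defined s ∧ NormalForm R (s.subst σ) ∧
        (s.subst σ).depth R.defined ≤ n := by
      intro s hs
      obtain ⟨i, hi, rfl⟩ := Multiset.mem_map.1 hs
      exact ⟨hls i, hσ.normalForm i, hσ.normal i (by simpa using hi)⟩
    have hsafe : ∀ s ∈ S.safeArgs ls, IsValue R.defined s ∧ NormalForm R (s.subst σ) ∧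
        (s.subst σ).depth R.defined ≤ m := by
      intro s hs
      obtain ⟨i, hi, rfl⟩ := Multiset.mem_map.1 hs
      exact ⟨hls i, hσ.normalForm i, hσ.safe i (by simpa using hi)⟩
    have hN := hn.mulGE.normalForm_depth_le hadm hQ hnormal
    have hM := hm.normalForm_depth_le hadm hQ hsafe
    have hmemN : ∀ j, j ∉ S.safe g → ts j ∈ S.normalArgs ts := fun j hj =>
      Multiset.mem_map_of_mem _ (by simpa using hj)
    have hmemM : ∀ j, j ∈ S.safe g → ts j ∈ S.safeArgs ts := fun j hj =>
      Multiset.mem_map_of_mem _ (by simpa using hj)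
    refine (hrec g (fun j => (ts j).subst σ) hfg ⟨fun j => ?_, fun j hj => (hN _ (hmemN j hj)).2,
      fun j hj => (hM _ (hmemM j hj)).2⟩ ?_).mono (by simp) (by simp)
    · by_cases hj : j ∈ S.safe g
      exacts [(hM _ (hmemM j hj)).1, (hN _ (hmemN j hj)).1]
    · simpa [normalDepths, SafeMapping.normalArgs, Function.comp_def] using
        hn.isDershowitzMannaLT hadm hQ fun s hs => ⟨(hnormal s hs).1, (hnormal s hs).2.1⟩

/-- A common bound for the right-hand sides of all rules whose root is equivalent to `f`. -/
theorem exists_rhs_bound (hR : R.IsConstructor) (hadm : Admissible R.defined)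
    (hpop : ∀ l r, (l, r) ∈ R.rules → Gpop S l r) (f : F) {p : Polynomial ℕ}
    (hp : ∀ g ∈ R.defined, g < f → CallBound S g p) :
    ∃ q : Polynomial ℕ, ∀ (f' : F) (ls : Fin (ar f') → Term ar V) (r : Term ar V),
      AntisymmRel (· ≤ ·) f f' → (Term.app f' ls, r) ∈ R.rules →
      ∀ (σ : V → Term ar V) (n m a b : ℕ), ArgsBounded S (fun i => (ls i).subst σ) n m →
      (∀ (g : F) (us : Fin (ar g) → Term ar V), AntisymmRel (· ≤ ·) f g →
        ArgsBounded S us n m →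
        (normalDepths S us).IsDershowitzMannaLT (normalDepths S fun i => (ls i).subst σ) →
        Bounded R (.app g us) a (m + b)) →
      Bounded R (r.subst σ) (a + q.eval n) (m + b + q.eval n) := by
  have key : ∀ ρ : Term ar V × Term ar V, ∃ q : Polynomial ℕ, ρ ∈ R.rules →
      ∀ (f' : F) (ls : Fin (ar f') → Term ar V), AntisymmRel (· ≤ ·) f f' → ρ.1 = .app f' ls →
      ∀ (σ : V → Term ar V) (n m a b : ℕ), ArgsBounded S (fun i => (ls i).subst σ) n m →
      (∀ (g : F) (us : Fin (ar g) → Term ar V), AntisymmRel (· ≤ ·) f g →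
        ArgsBounded S us n m →
        (normalDepths S us).IsDershowitzMannaLT (normalDepths S fun i => (ls i).subst σ) →
        Bounded R (.app g us) a (m + b)) →
      Bounded R (ρ.2.subst σ) (a + q.eval n) (m + b + q.eval n) := by
    rintro ⟨l, r⟩
    cases l with
    | var x => exact ⟨0, fun _ f' ls _ h => by simp at h⟩
    | app f' ls =>
      by_cases h : (Term.app f' ls, r) ∈ R.rules ∧ AntisymmRel (· ≤ ·) f f'
      · obtain ⟨hρ, hff'⟩ := h
        have hb := hR _ _ hρ
        obtain ⟨q, hq⟩ := (hpop _ _ hρ).exists_bound hadm hb.1 hb.2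
          (fun g hg hgf => hp g hg (hgf.trans_le hff'.2))
        refine ⟨q, fun _ f'' ls' _ heq σ n m a b hσ hrec => ?_⟩
        obtain ⟨rfl, h'⟩ := Term.app.inj heq
        obtain rfl := eq_of_heq h'
        exact hq σ n m a b hσ fun g us hfg => hrec g us (hff'.trans hfg)
      · refine ⟨0, fun hρ f'' ls' hf'' heq => absurd ⟨hρ, ?_⟩ h⟩
        obtain ⟨rfl, -⟩ := Term.app.inj heq
        exact hf''
  choose q hq using key
  refine ⟨∑ ρ ∈ R.finite_rules.toFinset, q ρ, fun f' ls r hff' hρ σ n m a b hσ hrec => ?_⟩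
  have hle : (q (.app f' ls, r)).eval n ≤
      (∑ ρ ∈ R.finite_rules.toFinset, q ρ).eval n := by
    rw [Polynomial.eval_finsetSum]
    exact Finset.single_le_sum (f := fun ρ => (q ρ).eval n) (fun _ _ => Nat.zero_le _)
      (R.finite_rules.mem_toFinset.2 hρ)
  exact (hq _ hρ f' ls hff' rfl σ n m a b hσ hrec).mono (by omega) (by omega)

/-- Induction on a strict bound `k` for the multiset rank, simultaneously for all symbols equivalent
to `f`, with `n` and `m` fixed. This is possible because recursive calls exceed neither depth bound.
-/
theorem exists_callBound_of_lower (hR : R.IsConstructor) (hadm : Admissible R.defined)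
    (hpop : ∀ l r, (l, r) ∈ R.rules → Gpop S l r) {f : F} (hf : f ∈ R.defined)
    {p : Polynomial ℕ} (hp : ∀ g ∈ R.defined, g < f → CallBound S g p) :
    ∃ q : Polynomial ℕ, CallBound S f q := by
  obtain ⟨q, hq⟩ := exists_rhs_bound hR hadm hpop f hp
  -- Equivalent symbols may differ in arity; `K` bounds the number of normal arguments for all of
  -- them.
  set K := R.finite_defined.toFinset.sup ar with hK
  have key : ∀ (n m k : ℕ) (g : F) (us : Fin (ar g) → Term ar V), AntisymmRel (· ≤ ·) f g →
      ArgsBounded S us n m → multisetRank n K (normalDepths S us) < k →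
      Bounded R (.app g us) (k * (q.eval n + 1)) (m + k * (q.eval n + 1)) := by
    intro n m k
    induction k with
    | zero => intro g us _ _ h; exact absurd h (Nat.not_lt_zero _)
    | succ k ih =>
      intro g us hfg hus hrank
      have hg : g ∈ R.defined := (hadm.2 f g hfg).1 hf
      have hstep : Bounded R (.app g us) (k * (q.eval n + 1) + q.eval n + 1)
          (m + k * (q.eval n + 1) + q.eval n) := by
        refine Bounded.of_step (by simp [Term.depth_app_of_mem hg]) fun u hu => ?_
        generalize hs : Term.app g us = s at hu
        cases hu with
        | root l r hlr σ _ =>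
          cases l with
          | var y => exact absurd rfl (R.lhs_not_var _ _ hlr y)
          | app g' ls =>
            obtain ⟨rfl, h'⟩ := Term.app.inj hs
            obtain rfl := eq_of_heq h'
            refine hq g ls r hfg hlr σ n m _ _ hus fun g' vs hfg' hvs hlt => ?_
            refine ih g' vs hfg' hvs (lt_of_lt_of_le (multisetRank_lt ?_ ?_ hlt)
              (Nat.lt_succ_iff.1 hrank))
            · intro x hx
              obtain ⟨v, hv, rfl⟩ := Multiset.mem_map.1 hx
              obtain ⟨i, hi, rfl⟩ := Multiset.mem_map.1 hv
              exact hvs.normal i (by simpa using hi)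
            · refine (card_normalDepths_le S vs).trans (Finset.le_sup (f := ar) ?_)
              exact R.finite_defined.mem_toFinset.2 ((hadm.2 f g' hfg').1 hf)
        | arg g' vs i h =>
          obtain ⟨rfl, h'⟩ := Term.app.inj hs
          obtain rfl := eq_of_heq h'
          exact absurd h.rew (hus.normalForm i _)
      -- One unfolding adds at most `q(n) + 1` to both bounds.
      exact hstep.mono (by ring_nf; omega) (by ring_nf; omega)
  -- The rank is at most `(n+2)^K`; the extra one makes the bound strict.
  refine ⟨((Polynomial.X + 2) ^ K + 1) * (q + 1), fun us n m hus => ?_⟩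
  have := key n m ((n + 2) ^ K + 1) f us (AntisymmRel.refl _ f) hus
    (Nat.lt_succ_of_le (multisetRank_le n K _))
  simpa using this

theorem exists_callBound (hR : R.IsConstructor) (hadm : Admissible R.defined)
    (hpop : ∀ l r, (l, r) ∈ R.rules → Gpop S l r) :
    ∃ q : Polynomial ℕ, ∀ f ∈ R.defined, CallBound S f q := by
  have key : ∀ f : F, f ∈ R.defined → ∃ q : Polynomial ℕ, CallBound S f q := by
    have hwf : R.defined.WellFoundedOn (· < ·) := R.finite_defined.wellFoundedOn
    intro f hf
    refine hwf.induction (P := fun f => ∃ q : Polynomial ℕ, CallBound S f q) hf fun f hf ih => ?_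
    choose! q hq using ih
    refine exists_callBound_of_lower hR hadm hpop hf
      (p := ∑ g ∈ R.finite_defined.toFinset, q g) fun g hg hgf => ?_
    refine (hq g hg hgf).mono fun n => ?_
    rw [Polynomial.eval_finsetSum]
    exact Finset.single_le_sum (f := fun g => (q g).eval n) (fun _ _ => Nat.zero_le _)
      (R.finite_defined.mem_toFinset.2 hg)
  choose! q hq using key
  refine ⟨∑ g ∈ R.finite_defined.toFinset, q g, fun g hg => (hq g hg).mono fun n => ?_⟩
  rw [Polynomial.eval_finsetSum]
  exact Finset.single_le_sum (f := fun g => (q g).eval n) (fun _ _ => Nat.zero_le _)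
    (R.finite_defined.mem_toFinset.2 hg)

end Calls
end PopStar

theorem theoremt {F V : Type*} [Preorder F] [Countable V] [Infinite V] (ar : F → ℕ)
    (R : PopStar.TRS ar V) (hR : R.IsConstructor)
    (hadm : PopStar.Admissible R.defined)
    (S : PopStar.SafeMapping ar R.defined)
    (hpop : ∀ l r, (l, r) ∈ R.rules → PopStar.Gpop S l r) :
    ∃ p : Polynomial ℕ, ∀ n : ℕ, PopStar.innermostRC R n ≤ ((p.eval n : ℕ) : ℕ∞) := by
  obtain ⟨p, hp⟩ := PopStar.exists_callBound hR hadm hpop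
  refine ⟨p, fun n => iSup₂_le fun t ht => iSup₂_le fun k hk => ?_⟩
  obtain ⟨u, hu⟩ := hk
  obtain ⟨hb, hn⟩ := ht
  cases t with
  | var x => exact hb.elim
  | app f ts =>
    -- The arguments of a basic term are normal forms, and their depth is at most its size, so `n`
    -- serves as both depth bounds.
    have hd : ∀ i, (ts i).depth R.defined ≤ n := fun i =>
      ((ts i).depth_le_size _).trans (le_trans (Finset.single_le_sum (f := fun i => (ts i).size)
        (fun _ _ => Nat.zero_le _) (Finset.mem_univ i)) ((Nat.le_add_left _ 1).trans hn))
    exact_mod_cast (hp f hb.1 ts n n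
      ⟨fun i => (hb.2 i).normalForm, fun i _ => hd i, fun i _ => hd i⟩ k u hu).1
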